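/- Let $(X,\|\cdot\|)$ be a Banach space, $a<b$ real, $f\in C^1([a,b],X)$, $0<\beta<1$, $m\in\mathbb N=\{1,2,\dots\}$, and let $n\in\mathbb N$ satisfy $n^{1-\beta}>2$ and $\lceil na\rceil\le\lfloor nb\rfloor$. Put $$\varphi(x)=\frac{x}{\sqrt[2m]{1+x^{2m}}},\qquad \Phi(x)=\tfrac14\bigl[\varphi(x+1)-\varphi(x-1)\bigr],\qquad A_n(f,x)=\frac{\sum_{k=\lceil na\rceil}^{\lfloor nb\rfloor}f(k/n)\,\Phi(nx-k)}{\sum_{k=\lceil na\rceil}^{\lfloor nb\rfloor}\Phi(nx-k)}\quad(x\in[a,b]).$$ For $x\in[a,b]$ let $$D_{*x}^{1/2}f(y)=\frac1{\Gamma(1/2)}\int_x^y (y-t)^{-1/2}f'(t)\,dt\ \ (y\in[x,b]),\qquad D_{x-}^{1/2}f(y)=\frac{-1}{\Gamma(1/2)}\int_y^x (z-y)^{-1/2}f'(z)\,dz\ \ (y\in[a,x])$$ be the left and right Caputo derivatives of order $\tfrac12$ (Bochner integrals). For $g$ defined on an interval $I$ let $\omega_1(g,\delta)_I=\sup\{\|g(y)-g(z)\|: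 y,z\in I,\ |y-z|\le\delta\}$ and $\|g\|_{\infty,I}=\sup_{y\in I}\|g(y)\|$, and write $\|\cdot\|_\infty=\|\cdot\|_{\infty,[a,b]}$. Then: i) for every $x\in[a,b]$, $$\|A_n(f,x)-f(x)\|\le\frac{4\sqrt[2m]{1+4^m}}{\sqrt\pi}\left\{\frac{\omega_1\bigl(D_{x-}^{1/2}f,\frac1{n^\beta}\bigr)_{[a,x]}+\omega_1\bigl(D_{*x}^{1/2}f,\frac1{n^\beta}\bigr)_{[x,b]}}{n^{\beta/2}}+\frac{\|D_{x-}^{1/2}f\|_{\infty,[a,x]}\sqrt{x-a}+\|D_{*x}^{1/2}f\|_{\infty,[x,b]}\sqrt{b-x}}{4m\,(n^{1-\beta}-2)^{2m}}\right\};$$ ii) $$\|A_nf-f\|_\infty\le\frac{4\sqrt[2m]{1+4^m}}{\sqrt\pi}\left\{\frac{\sup_{x\in[a,b]}\omega_1\bigl(D_{x-}^{1/2}f,\frac1{n^\beta}\bigr)_{[a,x]}+\sup_{x\in[a,b]}\omega_1\bigl(D_{*x}^{1/2}f,\frac1{n^\beta}\bigr)_{[x,b]}}{n^{\beta/2}}+\frac{\sqrt{b-a}}{4m\,(n^{1-\beta}-2)^{2m}}\Bigl(\sup_{x\in[a,b]}\|D_{x-}^{1/2}f\|_{\infty,[a,x]}+\sup_{x\in[a,b]}\|D_{*x}^{1/2}f\|_{\infty,[x,b]}\Bigr)\right\}<\infty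 .$$ -/

import Mathlib

open scoped ENNReal

namespace NeuralFrac

/-- The algebraic sigmoidal function `φ(x) = x / (1 + x^(2m))^(1/(2m))`. -/
noncomputable def sigmoid (m : ℕ) (x : ℝ) : ℝ :=
  x / (1 + x ^ (2 * m)) ^ (1 / (2 * (m : ℝ)))

/-- The activation (density) function `Φ(x) = (φ(x+1) - φ(x-1)) / 4`. -/
noncomputable def density (m : ℕ) (x : ℝ) : ℝ :=
  (1 / 4) * (sigmoid m (x + 1) - sigmoid m (x - 1))

variable {X : Type*} [NormedAddCommGroup X] [NormedSpace ℝ X]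

/-- The normalized `X`-valued neural network operator `A_n(f, x)` on `[a, b]`; it is meaningful
when `⌈na⌉ ≤ ⌊nb⌋`. -/
noncomputable def netOp (m : ℕ) (a b : ℝ) (n : ℕ) (f : ℝ → X) (x : ℝ) : X :=
  (∑ k ∈ Finset.Icc ⌈(n : ℝ) * a⌉ ⌊(n : ℝ) * b⌋, density m ((n : ℝ) * x - (k : ℝ)))⁻¹ •
    ∑ k ∈ Finset.Icc ⌈(n : ℝ) * a⌉ ⌊(n : ℝ) * b⌋,
      density m ((n : ℝ) * x - (k : ℝ)) • f ((k : ℝ) / (n : ℝ))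

/-- The left Caputo-Bochner fractional derivative `(D_{*x₀}^α f)(x)` of order `α ≥ 0` with base
point `x₀`, for `f` on `[a, b]` and `x₀, x ∈ [a, b]`. It is set to be `0` for `x < x₀`, and it is
the ordinary derivative when `α` is a natural number. -/
noncomputable def caputoLeft (α a b : ℝ) (f : ℝ → X) (x₀ x : ℝ) : X :=
  if x < x₀ then 0
  else if α = (⌈α⌉₊ : ℝ) then iteratedDerivWithin ⌈α⌉₊ f (Set.Icc a b) x
  else (1 / Real.Gamma ((⌈α⌉₊ : ℝ) - α)) •
    ∫ t in x₀..x, (x - t) ^ ((⌈α⌉₊ : ℝ) - α - 1) • iteratedDerivWithin ⌈α⌉₊ f (Set.Icc a b) t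

/-- The right Caputo-Bochner fractional derivative `(D_{x₀-}^α f)(x)` of order `α ≥ 0` with base
point `x₀`, for `f` on `[a, b]` and `x₀, x ∈ [a, b]`. It is set to be `0` for `x > x₀`, and it is
`(-1)^α` times the ordinary derivative when `α` is a natural number. -/
noncomputable def caputoRight (α a b : ℝ) (f : ℝ → X) (x₀ x : ℝ) : X :=
  if x₀ < x then 0
  else if α = (⌈α⌉₊ : ℝ) then
    ((-1 : ℝ) ^ ⌈α⌉₊) • iteratedDerivWithin ⌈α⌉₊ f (Set.Icc a b) x
  else ((-1 : ℝ) ^ ⌈α⌉₊ / Real.Gamma ((⌈α⌉₊ : ℝ) - α)) •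
    ∫ z in x..x₀, (z - x) ^ ((⌈α⌉₊ : ℝ) - α - 1) • iteratedDerivWithin ⌈α⌉₊ f (Set.Icc a b) z

/-- The first modulus of continuity `ω₁(g, δ)_S`, as a supremum in `[0, ∞]`. -/
noncomputable def modulus (g : ℝ → X) (δ : ℝ) (S : Set ℝ) : ℝ≥0∞ :=
  ⨆ y ∈ S, ⨆ z ∈ S, ⨆ _ : |y - z| ≤ δ, ‖g y - g z‖ₑ

/-- The supremum norm `‖g‖_{∞, S}`, as a supremum in `[0, ∞]`. -/
noncomputable def supNorm (g : ℝ → X) (S : Set ℝ) : ℝ≥0∞ :=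
  ⨆ y ∈ S, ‖g y‖ₑ

end NeuralFrac

/-! The Riemann–Liouville integral `I^α` inverts the left Caputo derivative `D^α`: by Fubini and the
Beta integral these integrals form a semigroup, so that `I^α I^(1 - α)` is ordinary integration.
Hence `f y - f x = I^α (D^α f) y` with base point `x`, and the reflection `t ↦ -t` gives the same
for the right derivative. As `D^α f` vanishes at `x`, its size near `x` is controlled by its modulus
of continuity; away from `x` one uses its supremum norm.

`A_n f x` is a weighted mean of the values `f (k / n)`. The density is a discrete derivative of the
sigmoid, so sums of its translates telescope, which bounds the total weight by `1` and, with
Bernoulli's inequality, the weight of the `k` far from `n x` by a negative power of the distance.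
The sigmoid is subadditive on `[0, ∞)`, hence the density is at least `φ(2) / 4` on `[-1, 1]`,
which bounds the normalizing sum from below. -/

namespace NeuralFrac

section SupNorm

variable {X : Type*} [NormedAddCommGroup X] {g : ℝ → X} {S T : Set ℝ} {x y z δ : ℝ}

theorem enorm_le_supNorm (g : ℝ → X) (hy : y ∈ S) : ‖g y‖ₑ ≤ supNorm g S :=
  le_biSup (fun y => ‖g y‖ₑ) hy

theorem supNorm_mono (g : ℝ → X) (hTS : T ⊆ S) : supNorm g T ≤ supNorm g S :=
  biSup_mono hTS

theorem supNorm_comp_neg (g : ℝ → X) (S : Set ℝ) :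
    supNorm (fun y => g (-y)) (-S) = supNorm g S := by
  simp only [supNorm, Set.mem_neg]
  exact (Equiv.neg ℝ).iSup_congr fun y => rfl

theorem supNorm_lt_top_of_continuousOn (hS : IsCompact S) (hg : ContinuousOn g S) :
    supNorm g S < ∞ := by
  obtain ⟨B, hB⟩ := hS.exists_bound_of_continuousOn hg
  refine lt_of_le_of_lt (iSup₂_le fun y hy => ?_) (ENNReal.ofReal_lt_top (r := B))
  rw [← ofReal_norm]
  exact ENNReal.ofReal_le_ofReal (hB y hy)

theorem enorm_sub_le_modulus (g : ℝ → X) (hy : y ∈ S) (hz : z ∈ S) (hyz : |y - z| ≤ δ) :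
    ‖g y - g z‖ₑ ≤ modulus g δ S :=
  le_iSup₂_of_le y hy (le_iSup₂_of_le z hz (le_iSup_of_le hyz le_rfl))

theorem modulus_le_two_mul_supNorm (g : ℝ → X) (δ : ℝ) (S : Set ℝ) :
    modulus g δ S ≤ 2 * supNorm g S := by
  refine iSup₂_le fun y hy => iSup₂_le fun z hz => iSup_le fun _ => ?_
  rw [two_mul]
  exact enorm_sub_le.trans (add_le_add (enorm_le_supNorm g hy) (enorm_le_supNorm g hz))

theorem biSup_modulus_lt_top {s : Set ℝ} {g : ℝ → ℝ → X} {T : ℝ → Set ℝ}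
    (hg : ⨆ x ∈ s, supNorm (g x) (T x) < ∞) (δ : ℝ) : ⨆ x ∈ s, modulus (g x) δ (T x) < ∞ := by
  refine lt_of_le_of_lt (iSup₂_le fun x hx => ?_)
    (ENNReal.mul_lt_top (ENNReal.ofNat_lt_top (n := 2)) hg)
  refine (modulus_le_two_mul_supNorm (g x) δ (T x)).trans ?_
  gcongr
  exact le_biSup (fun x => supNorm (g x) (T x)) hx

theorem supNorm_le_modulus (hTS : T ⊆ S) (hx : x ∈ S) (hgx : g x = 0)
    (hT : ∀ t ∈ T, |t - x| ≤ δ) : supNorm g T ≤ modulus g δ S :=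
  iSup₂_le fun t ht => by
    simpa only [hgx, sub_zero] using enorm_sub_le_modulus g (hTS ht) hx (hT t ht)

theorem mul_supNorm_le_modulus_add_ite {c : ℝ → ℝ≥0∞} (hc : MonotoneOn c (Set.Ici 0)) {r l : ℝ}
    (hr : 0 ≤ r) (hrl : r ≤ l) (hTS : T ⊆ S) (hx : x ∈ S) (hgx : g x = 0)
    (hT : ∀ t ∈ T, |t - x| ≤ r) :
    c r * supNorm g T ≤ c δ * modulus g δ S + if δ < r then c l * supNorm g S else 0 := by
  split_ifs with hδr
  · exact (mul_le_mul' (hc hr (hr.trans hrl) hrl) (supNorm_mono g hTS)).trans le_add_self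
  · rw [not_lt] at hδr
    rw [add_zero]
    exact mul_le_mul' (hc hr (hr.trans hδr) hδr)
      (supNorm_le_modulus hTS hx hgx fun t ht => (hT t ht).trans hδr)

end SupNorm

section FractionalIntegral

open MeasureTheory

variable {X : Type*} [NormedAddCommGroup X] [NormedSpace ℝ X] {α β x y s : ℝ} {g : ℝ → X}

/-- The Riemann–Liouville fractional integral `(I_{x+}^α g)(y)` of order `α > 0` with base point
`x ≤ y`: the operator that inverts the left Caputo derivative. -/
noncomputable def fracIntegral (α x : ℝ) (g : ℝ → X) (y : ℝ) : X :=
  (Real.Gamma α)⁻¹ • ∫ t in x..y, (y - t) ^ (α - 1) • g t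

theorem fracIntegral_self : fracIntegral α x g x = 0 := by
  simp [fracIntegral]

theorem fracIntegral_one : fracIntegral 1 x g y = ∫ t in x..y, g t := by
  simp [fracIntegral]

theorem fracIntegral_congr {h : ℝ → X} (hxy : x ≤ y) (hgh : Set.EqOn g h (Set.Icc x y)) :
    fracIntegral α x g y = fracIntegral α x h y := by
  unfold fracIntegral
  congr 1
  refine intervalIntegral.integral_congr fun t ht => ?_
  rw [Set.uIcc_of_le hxy] at ht
  rw [hgh ht]

theorem integral_rpow_sub (hα : 0 < α) (x y : ℝ) :
    ∫ t in x..y, (y - t) ^ (α - 1) = (y - x) ^ α / α := by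
  rw [intervalIntegral.integral_comp_sub_left (fun u => u ^ (α - 1)) y, sub_self,
    integral_rpow (.inl (by linarith)), sub_add_cancel, Real.zero_rpow hα.ne', sub_zero]

theorem intervalIntegrable_rpow_sub (hα : 0 < α) (x y : ℝ) :
    IntervalIntegrable (fun t => (y - t) ^ (α - 1)) volume x y := by
  simpa using (intervalIntegral.intervalIntegrable_rpow' (a := y - x) (b := 0)
    (show -1 < α - 1 by linarith)).comp_sub_left y

theorem enorm_integral_rpow_sub_smul_le (hα : 0 < α) (hxy : x ≤ y) (g : ℝ → X) :
    ‖∫ t in x..y, (y - t) ^ (α - 1) • g t‖ₑ ≤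
      ENNReal.ofReal ((y - x) ^ α / α) * supNorm g (Set.Icc x y) := by
  have hnonneg : ∀ t ∈ Set.Ioc x y, 0 ≤ (y - t) ^ (α - 1) := fun t ht =>
    Real.rpow_nonneg (sub_nonneg.2 ht.2) _
  rw [← integral_rpow_sub hα, intervalIntegral.integral_of_le hxy,
    intervalIntegral.integral_of_le hxy]
  calc ‖∫ t in Set.Ioc x y, (y - t) ^ (α - 1) • g t‖ₑ
      ≤ ∫⁻ t in Set.Ioc x y, ‖(y - t) ^ (α - 1) • g t‖ₑ := enorm_integral_le_lintegral_enorm _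
    _ ≤ ∫⁻ t in Set.Ioc x y, ENNReal.ofReal ((y - t) ^ (α - 1)) * supNorm g (Set.Icc x y) := by
        refine setLIntegral_mono' measurableSet_Ioc fun t ht => ?_
        rw [enorm_smul, Real.enorm_of_nonneg (hnonneg t ht)]
        gcongr
        exact enorm_le_supNorm g ⟨ht.1.le, ht.2⟩
    _ = ENNReal.ofReal (∫ t in Set.Ioc x y, (y - t) ^ (α - 1)) * supNorm g (Set.Icc x y) := by
        have hint := (intervalIntegrable_iff_integrableOn_Ioc_of_le hxy).1
          (intervalIntegrable_rpow_sub hα x y)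
        rw [lintegral_mul_const _ (by fun_prop), ofReal_integral_eq_lintegral_ofReal hint
          ((ae_restrict_iff' measurableSet_Ioc).2 (.of_forall hnonneg))]

theorem enorm_fracIntegral_le (hα : 0 < α) (hxy : x ≤ y) (g : ℝ → X) :
    ‖fracIntegral α x g y‖ₑ ≤
      ENNReal.ofReal ((y - x) ^ α / Real.Gamma (α + 1)) * supNorm g (Set.Icc x y) := by
  have hΓ : 0 < (Real.Gamma α)⁻¹ := inv_pos.2 (Real.Gamma_pos_of_pos hα)
  have hconst : (y - x) ^ α / Real.Gamma (α + 1) = (Real.Gamma α)⁻¹ * ((y - x) ^ α / α) := by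
    rw [Real.Gamma_add_one hα.ne']; field_simp
  rw [hconst, ENNReal.ofReal_mul hΓ.le, mul_assoc, fracIntegral, enorm_smul,
    Real.enorm_of_nonneg hΓ.le]
  gcongr
  exact enorm_integral_rpow_sub_smul_le hα hxy g

theorem integral_rpow_mul_rpow (hα : 0 < α) (hβ : 0 < β) (hsy : s < y) :
    ∫ t in s..y, (y - t) ^ (α - 1) * (t - s) ^ (β - 1) =
      ProbabilityTheory.beta α β * (y - s) ^ (α + β - 1) := by
  have hys : 0 < y - s := sub_pos.2 hsy
  have hcast : ((∫ u in 0..(y - s), (y - s - u) ^ (α - 1) * u ^ (β - 1) : ℝ) : ℂ) =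
      (y - s : ℝ) ^ ((β : ℂ) + α - 1) * Complex.betaIntegral β α := by
    rw [← Complex.betaIntegral_scaled _ _ hys, ← intervalIntegral.integral_ofReal]
    refine intervalIntegral.integral_congr fun u hu => ?_
    rw [Set.uIcc_of_le hys.le] at hu
    rw [mul_comm]
    push_cast
    rw [Complex.ofReal_cpow hu.1, Complex.ofReal_cpow (sub_nonneg.2 hu.2)]
    push_cast
    rfl
  have hshift := intervalIntegral.integral_comp_sub_right
    (fun u => (y - s - u) ^ (α - 1) * u ^ (β - 1)) s (a := s) (b := y)
  simp only [sub_sub_sub_cancel_right, sub_self] at hshift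
  rw [hshift, ProbabilityTheory.beta_eq_betaIntegralReal α β hα hβ, ← Complex.betaIntegral_symm]
  have hre := congrArg Complex.re hcast
  rw [Complex.ofReal_re, ← Complex.ofReal_add, ← Complex.ofReal_one, ← Complex.ofReal_sub,
    ← Complex.ofReal_cpow hys.le, Complex.re_ofReal_mul, add_comm β, mul_comm] at hre
  exact hre

theorem intervalIntegrable_rpow_mul_rpow (hα : 0 < α) (hβ : 0 < β) (hsy : s < y) :
    IntervalIntegrable (fun t => (y - t) ^ (α - 1) * (t - s) ^ (β - 1)) volume s y := by
  refine not_imp_comm.1 intervalIntegral.integral_undef ?_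
  rw [integral_rpow_mul_rpow hα hβ hsy]
  have := ProbabilityTheory.beta_pos hα hβ
  have := sub_pos.2 hsy
  positivity

/-- The kernel `(y - t)^(α - 1) (t - s)^(β - 1)` of the composition of two fractional integrals,
extended by `0` to `t ≤ s` so that Fubini's theorem applies to it on a square. -/
noncomputable def fracKernel (α β y t s : ℝ) : ℝ :=
  if s < t then (y - t) ^ (α - 1) * (t - s) ^ (β - 1) else 0

theorem measurable_fracKernel (α β y : ℝ) :
    Measurable fun p : ℝ × ℝ => fracKernel α β y p.1 p.2 := by
  unfold fracKernel
  exact Measurable.ite (measurableSet_lt measurable_snd measurable_fst) (by fun_prop) (by fun_prop)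

theorem fracKernel_nonneg {t : ℝ} (hty : t ≤ y) (s : ℝ) : 0 ≤ fracKernel α β y t s := by
  unfold fracKernel
  split_ifs with hst
  · have := sub_nonneg.2 hty
    have := sub_pos.2 hst
    positivity
  · exact le_rfl

theorem fracKernel_eq_indicator_Ioi (α β y s : ℝ) :
    (fun t => fracKernel α β y t s) =
      (Set.Ioi s).indicator fun t => (y - t) ^ (α - 1) * (t - s) ^ (β - 1) := by
  ext t; simp [fracKernel, Set.indicator]

theorem integrableOn_fracKernel (hα : 0 < α) (hβ : 0 < β) (hxs : x ≤ s) (hsy : s < y) :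
    IntegrableOn (fun t => fracKernel α β y t s) (Set.Ioc x y) := by
  rw [fracKernel_eq_indicator_Ioi, integrableOn_indicator_iff measurableSet_Ioi, Set.inter_comm,
    Set.Ioc_inter_Ioi, sup_eq_right.2 hxs, ← intervalIntegrable_iff_integrableOn_Ioc_of_le hsy.le]
  exact intervalIntegrable_rpow_mul_rpow hα hβ hsy

theorem setIntegral_fracKernel (hα : 0 < α) (hβ : 0 < β) (hxs : x ≤ s) (hsy : s < y) :
    ∫ t in Set.Ioc x y, fracKernel α β y t s =
      ProbabilityTheory.beta α β * (y - s) ^ (α + β - 1) := by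
  rw [fracKernel_eq_indicator_Ioi, setIntegral_indicator measurableSet_Ioi, Set.Ioc_inter_Ioi,
    sup_eq_right.2 hxs, ← intervalIntegral.integral_of_le hsy.le, integral_rpow_mul_rpow hα hβ hsy]

theorem ae_restrict_Ioc_mem_Ioo (x y : ℝ) :
    ∀ᵐ s ∂volume.restrict (Set.Ioc x y), s ∈ Set.Ioo x y := by
  rw [← restrict_Ioo_eq_restrict_Ioc]
  exact ae_restrict_mem measurableSet_Ioo

theorem integrableOn_rpow_sub_smul (hα : 1 ≤ α) (hg : IntegrableOn g (Set.Ioc x y)) :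
    IntegrableOn (fun s => (y - s) ^ (α - 1) • g s) (Set.Ioc x y) := by
  have hcont : Continuous fun s => (y - s) ^ (α - 1) :=
    (continuous_const.sub continuous_id).rpow_const fun _ => .inr (by linarith)
  rw [← integrableOn_Icc_iff_integrableOn_Ioc] at hg ⊢
  exact hg.continuousOn_smul hcont.continuousOn isCompact_Icc

theorem integrable_fracKernel_smul (hα : 0 < α) (hβ : 0 < β) (hαβ : 1 ≤ α + β)
    (hg : IntegrableOn g (Set.Ioc x y)) :
    Integrable (Function.uncurry fun t s => fracKernel α β y t s • g s)
      ((volume.restrict (Set.Ioc x y)).prod (volume.restrict (Set.Ioc x y))) := by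
  have hmeas : AEStronglyMeasurable (Function.uncurry fun t s => fracKernel α β y t s • g s)
      ((volume.restrict (Set.Ioc x y)).prod (volume.restrict (Set.Ioc x y))) :=
    (measurable_fracKernel α β y).aestronglyMeasurable.smul hg.aestronglyMeasurable.comp_snd
  rw [integrable_prod_iff' hmeas]
  constructor
  · filter_upwards [ae_restrict_Ioc_mem_Ioo x y] with s hs
    exact (integrableOn_fracKernel hα hβ hs.1.le hs.2).smul_const (g s)
  · refine ((integrableOn_rpow_sub_smul hαβ hg.norm).const_mul
      (ProbabilityTheory.beta α β)).congr ?_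
    filter_upwards [ae_restrict_Ioc_mem_Ioo x y] with s hs
    have hnorm : Set.EqOn (fun t => ‖fracKernel α β y t s • g s‖)
        (fun t => fracKernel α β y t s * ‖g s‖) (Set.Ioc x y) := fun t ht => by
      simp only [norm_smul, Real.norm_of_nonneg (fracKernel_nonneg ht.2 s)]
    simp only [Function.uncurry]
    rw [setIntegral_congr_fun measurableSet_Ioc hnorm, integral_mul_const,
      setIntegral_fracKernel hα hβ hs.1.le hs.2, smul_eq_mul, mul_assoc]

theorem setIntegral_fracKernel_smul {t : ℝ} (ht : t ∈ Set.Ioc x y) :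
    ∫ s in Set.Ioc x y, fracKernel α β y t s • g s =
      (y - t) ^ (α - 1) • ∫ s in x..t, (t - s) ^ (β - 1) • g s := by
  have hind : (fun s => fracKernel α β y t s • g s) = (Set.Iio t).indicator fun s =>
      (y - t) ^ (α - 1) • (t - s) ^ (β - 1) • g s := by
    ext s; by_cases h : s < t <;> simp [fracKernel, h, mul_smul]
  have hIoo : Set.Ioc x y ∩ Set.Iio t = Set.Ioo x t := by
    ext s; exact ⟨fun h => ⟨h.1.1, h.2⟩, fun h => ⟨⟨h.1, h.2.le.trans ht.2⟩, h.2⟩⟩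
  rw [hind, setIntegral_indicator measurableSet_Iio, hIoo, ← integral_Ioc_eq_integral_Ioo,
    ← intervalIntegral.integral_of_le ht.1.le, intervalIntegral.integral_smul]

variable [CompleteSpace X]

theorem integral_rpow_sub_smul_integral (hα : 0 < α) (hβ : 0 < β) (hαβ : 1 ≤ α + β) (hxy : x ≤ y)
    (hg : IntegrableOn g (Set.Ioc x y)) :
    ∫ t in x..y, (y - t) ^ (α - 1) • ∫ s in x..t, (t - s) ^ (β - 1) • g s =
      ProbabilityTheory.beta α β • ∫ s in x..y, (y - s) ^ (α + β - 1) • g s := by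
  simp only [intervalIntegral.integral_of_le hxy]
  rw [← setIntegral_congr_fun measurableSet_Ioc fun t ht => setIntegral_fracKernel_smul ht,
    integral_integral_swap (integrable_fracKernel_smul hα hβ hαβ hg), ← integral_smul]
  refine integral_congr_ae ?_
  filter_upwards [ae_restrict_Ioc_mem_Ioo x y] with s hs
  rw [integral_smul_const, setIntegral_fracKernel hα hβ hs.1.le hs.2, mul_smul]

theorem fracIntegral_fracIntegral (hα : 0 < α) (hβ : 0 < β) (hαβ : 1 ≤ α + β) (hxy : x ≤ y)
    (hg : IntegrableOn g (Set.Ioc x y)) :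
    fracIntegral α x (fracIntegral β x g) y = fracIntegral (α + β) x g y := by
  have := Real.Gamma_pos_of_pos hα
  have := Real.Gamma_pos_of_pos hβ
  simp only [fracIntegral, smul_comm _ (Real.Gamma β)⁻¹, intervalIntegral.integral_smul]
  rw [integral_rpow_sub_smul_integral hα hβ hαβ hxy hg, smul_smul, smul_smul,
    ProbabilityTheory.beta]
  congr 1
  field_simp

end FractionalIntegral

section Caputo

open MeasureTheory

variable {X : Type*} [NormedAddCommGroup X] [NormedSpace ℝ X] {α a b x y : ℝ} {f : ℝ → X}

theorem caputoLeft_eq_fracIntegral (hα : α ∈ Set.Ioo 0 1) (hxy : x ≤ y) :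
    caputoLeft α a b f x y = fracIntegral (1 - α) x (derivWithin f (Set.Icc a b)) y := by
  have hceil : ⌈α⌉₊ = 1 := by
    rw [Nat.ceil_eq_iff one_ne_zero]
    simpa using ⟨hα.1, hα.2.le⟩
  rw [caputoLeft, if_neg hxy.not_gt, hceil, Nat.cast_one, if_neg hα.2.ne, iteratedDerivWithin_one,
    one_div, fracIntegral]

theorem caputoRight_eq_caputoLeft_comp_neg (α a b : ℝ) (f : ℝ → X) (x y : ℝ) :
    caputoRight α a b f x y = caputoLeft α (-b) (-a) (fun t => f (-t)) (-x) (-y) := by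
  have hderiv (t : ℝ) : iteratedDerivWithin ⌈α⌉₊ (fun t => f (-t)) (Set.Icc (-b) (-a)) t =
      (-1 : ℝ) ^ ⌈α⌉₊ • iteratedDerivWithin ⌈α⌉₊ f (Set.Icc a b) (-t) := by
    rw [iteratedDerivWithin_comp_neg, Set.neg_Icc, neg_neg, neg_neg]
  simp only [caputoRight, caputoLeft, neg_lt_neg_iff, hderiv, neg_neg]
  refine if_congr Iff.rfl rfl (if_congr Iff.rfl rfl ?_)
  rw [← intervalIntegral.integral_comp_neg]
  simp only [neg_neg, neg_sub_neg, smul_comm _ ((-1 : ℝ) ^ ⌈α⌉₊)]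
  rw [intervalIntegral.integral_smul, smul_smul, one_div_mul_eq_div]

theorem contDiffOn_comp_neg_Icc (hf : ContDiffOn ℝ 1 f (Set.Icc a b)) :
    ContDiffOn ℝ 1 (fun t => f (-t)) (Set.Icc (-b) (-a)) :=
  hf.comp contDiff_neg.contDiffOn fun _ ht => ⟨le_neg.1 ht.2, neg_le.1 ht.1⟩

theorem supNorm_caputoRight (α a b : ℝ) (f : ℝ → X) (x y z : ℝ) :
    supNorm (caputoRight α a b f x) (Set.Icc y z) =
      supNorm (caputoLeft α (-b) (-a) (fun t => f (-t)) (-x)) (Set.Icc (-z) (-y)) := by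
  rw [← Set.neg_Icc, ← supNorm_comp_neg]
  simp only [caputoRight_eq_caputoLeft_comp_neg α a b f x, neg_neg]

theorem caputoLeft_self (hα : α ∈ Set.Ioo 0 1) : caputoLeft α a b f x x = 0 := by
  rw [caputoLeft_eq_fracIntegral hα le_rfl, fracIntegral_self]

theorem caputoRight_self (hα : α ∈ Set.Ioo 0 1) : caputoRight α a b f x x = 0 := by
  rw [caputoRight_eq_caputoLeft_comp_neg, caputoLeft_self hα]

theorem supNorm_caputoLeft_le (hα : α ∈ Set.Ioo 0 1) (hax : a ≤ x) :
    supNorm (caputoLeft α a b f x) (Set.Icc x b) ≤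
      ENNReal.ofReal ((b - a) ^ (1 - α) / Real.Gamma (2 - α)) *
        supNorm (derivWithin f (Set.Icc a b)) (Set.Icc a b) := by
  refine iSup₂_le fun y hy => ?_
  have hα' : 0 < 1 - α := sub_pos.2 hα.2
  have hΓ : 0 < Real.Gamma (2 - α) := Real.Gamma_pos_of_pos (by linarith)
  have hsub : Set.Icc x y ⊆ Set.Icc a b := Set.Icc_subset_Icc hax hy.2
  have h := enorm_fracIntegral_le hα' hy.1 (derivWithin f (Set.Icc a b))
  rw [show 1 - α + 1 = 2 - α by ring] at h
  rw [caputoLeft_eq_fracIntegral hα hy.1]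
  refine h.trans (mul_le_mul' (ENNReal.ofReal_le_ofReal ?_) (supNorm_mono _ hsub))
  have := sub_nonneg.2 hy.1
  have := hy.2
  gcongr

theorem biSup_supNorm_caputoLeft_lt_top (hα : α ∈ Set.Ioo 0 1) (hab : a < b)
    (hf : ContDiffOn ℝ 1 f (Set.Icc a b)) :
    ⨆ x ∈ Set.Icc a b, supNorm (caputoLeft α a b f x) (Set.Icc x b) < ∞ :=
  lt_of_le_of_lt (iSup₂_le fun _ hx => supNorm_caputoLeft_le hα hx.1)
    (ENNReal.mul_lt_top ENNReal.ofReal_lt_top (supNorm_lt_top_of_continuousOn isCompact_Icc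
      (hf.continuousOn_derivWithin (uniqueDiffOn_Icc hab) le_rfl)))

theorem biSup_supNorm_caputoRight_lt_top (hα : α ∈ Set.Ioo 0 1) (hab : a < b)
    (hf : ContDiffOn ℝ 1 f (Set.Icc a b)) :
    ⨆ x ∈ Set.Icc a b, supNorm (caputoRight α a b f x) (Set.Icc a x) < ∞ := by
  refine lt_of_le_of_lt (iSup₂_le fun x hx => ?_)
    (biSup_supNorm_caputoLeft_lt_top hα (neg_lt_neg hab) (contDiffOn_comp_neg_Icc hf))
  rw [supNorm_caputoRight]
  exact le_iSup₂_of_le (-x) ⟨neg_le_neg hx.2, neg_le_neg hx.1⟩ le_rfl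

variable [CompleteSpace X]

theorem integral_derivWithin_Icc (hf : ContDiffOn ℝ 1 f (Set.Icc a b)) (hab : a < b) (hax : a ≤ x)
    (hxy : x ≤ y) (hyb : y ≤ b) :
    ∫ t in x..y, derivWithin f (Set.Icc a b) t = f y - f x := by
  have hsub : Set.Icc x y ⊆ Set.Icc a b := Set.Icc_subset_Icc hax hyb
  have hcont := hf.continuousOn_derivWithin (uniqueDiffOn_Icc hab) le_rfl
  refine intervalIntegral.integral_eq_sub_of_hasDerivAt_of_le hxy (hf.continuousOn.mono hsub)
    (fun t ht => ?_) ((hcont.mono hsub).intervalIntegrable_of_Icc hxy)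
  have ht' : t ∈ Set.Ioo a b := ⟨hax.trans_lt ht.1, ht.2.trans_le hyb⟩
  have hdiff := hf.differentiableOn one_ne_zero t (Set.Ioo_subset_Icc_self ht')
  exact hdiff.hasDerivWithinAt.hasDerivAt (Icc_mem_nhds ht'.1 ht'.2)

theorem fracIntegral_caputoLeft (hα : α ∈ Set.Ioo 0 1) (hab : a < b)
    (hf : ContDiffOn ℝ 1 f (Set.Icc a b)) (hax : a ≤ x) (hxy : x ≤ y) (hyb : y ≤ b) :
    fracIntegral α x (caputoLeft α a b f x) y = f y - f x := by
  have hint : IntegrableOn (derivWithin f (Set.Icc a b)) (Set.Ioc x y) :=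
    (hf.continuousOn_derivWithin (uniqueDiffOn_Icc hab) le_rfl).integrableOn_Icc.mono_set
      (Set.Ioc_subset_Icc_self.trans (Set.Icc_subset_Icc hax hyb))
  rw [fracIntegral_congr hxy fun t ht => caputoLeft_eq_fracIntegral hα ht.1,
    fracIntegral_fracIntegral hα.1 (sub_pos.2 hα.2) (by linarith) hxy hint, add_sub_cancel,
    fracIntegral_one, integral_derivWithin_Icc hf hab hax hxy hyb]

theorem enorm_sub_le_supNorm_caputoLeft (hα : α ∈ Set.Ioo 0 1) (hab : a < b)
    (hf : ContDiffOn ℝ 1 f (Set.Icc a b)) (hax : a ≤ x) (hxy : x ≤ y) (hyb : y ≤ b) :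
    ‖f y - f x‖ₑ ≤ ENNReal.ofReal ((y - x) ^ α / Real.Gamma (α + 1)) *
      supNorm (caputoLeft α a b f x) (Set.Icc x y) := by
  rw [← fracIntegral_caputoLeft hα hab hf hax hxy hyb]
  exact enorm_fracIntegral_le hα.1 hxy _

theorem enorm_sub_le_supNorm_caputoRight (hα : α ∈ Set.Ioo 0 1) (hab : a < b)
    (hf : ContDiffOn ℝ 1 f (Set.Icc a b)) (hay : a ≤ y) (hyx : y ≤ x) (hxb : x ≤ b) :
    ‖f y - f x‖ₑ ≤ ENNReal.ofReal ((x - y) ^ α / Real.Gamma (α + 1)) *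
      supNorm (caputoRight α a b f x) (Set.Icc y x) := by
  have h := enorm_sub_le_supNorm_caputoLeft hα (neg_lt_neg hab) (contDiffOn_comp_neg_Icc hf)
    (neg_le_neg hxb) (neg_le_neg hyx) (neg_le_neg hay)
  rwa [neg_neg, neg_neg, neg_sub_neg, ← supNorm_caputoRight] at h

theorem monotoneOn_ofReal_rpow_div_Gamma (hα : 0 ≤ α) :
    MonotoneOn (fun r => ENNReal.ofReal (r ^ α / Real.Gamma (α + 1))) (Set.Ici 0) := by
  intro r hr s _ hrs
  have := Real.Gamma_pos_of_pos (add_pos_of_nonneg_of_pos hα one_pos)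
  rw [Set.mem_Ici] at hr
  dsimp only
  gcongr

theorem enorm_sub_le_modulus_caputo (hα : α ∈ Set.Ioo 0 1) (hab : a < b)
    (hf : ContDiffOn ℝ 1 f (Set.Icc a b)) {δ : ℝ} (hδ : 0 ≤ δ) (hx : x ∈ Set.Icc a b)
    (hy : y ∈ Set.Icc a b) :
    ‖f y - f x‖ₑ ≤ ENNReal.ofReal (δ ^ α / Real.Gamma (α + 1)) *
          (modulus (caputoRight α a b f x) δ (Set.Icc a x) +
            modulus (caputoLeft α a b f x) δ (Set.Icc x b)) +
        (if δ < x - y then ENNReal.ofReal ((x - a) ^ α / Real.Gamma (α + 1)) *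
          supNorm (caputoRight α a b f x) (Set.Icc a x) else 0) +
        (if δ < y - x then ENNReal.ofReal ((b - x) ^ α / Real.Gamma (α + 1)) *
          supNorm (caputoLeft α a b f x) (Set.Icc x b) else 0) := by
  have hc := monotoneOn_ofReal_rpow_div_Gamma hα.1.le
  rcases le_total y x with hyx | hxy
  · have hnear_far := mul_supNorm_le_modulus_add_ite (δ := δ) hc (sub_nonneg.2 hyx)
      (sub_le_sub_left hy.1 x) (Set.Icc_subset_Icc_left hy.1) (Set.right_mem_Icc.2 hx.1)
      (caputoRight_self (a := a) (b := b) (f := f) hα) (fun t ht => by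
        rw [abs_sub_comm, abs_of_nonneg (sub_nonneg.2 ht.2)]; exact sub_le_sub_left ht.1 x)
    rw [if_neg (not_lt.2 ((sub_nonpos.2 hyx).trans hδ)), add_zero]
    refine (enorm_sub_le_supNorm_caputoRight hα hab hf hy.1 hyx hx.2).trans (hnear_far.trans ?_)
    gcongr
    exact le_self_add
  · have hnear_far := mul_supNorm_le_modulus_add_ite (δ := δ) hc (sub_nonneg.2 hxy)
      (sub_le_sub_right hy.2 x) (Set.Icc_subset_Icc_right hy.2) (Set.left_mem_Icc.2 hx.2)
      (caputoLeft_self (a := a) (b := b) (f := f) hα) (fun t ht => by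
        rw [abs_of_nonneg (sub_nonneg.2 ht.1)]; exact sub_le_sub_right ht.2 x)
    rw [if_neg (not_lt.2 ((sub_nonpos.2 hxy).trans hδ)), add_zero]
    refine (enorm_sub_le_supNorm_caputoLeft hα hab hf hx.1 hxy hy.2).trans (hnear_far.trans ?_)
    gcongr
    exact le_add_self

end Caputo

section Density

open scoped Pointwise

variable {m : ℕ} {x y c N : ℝ} {p q : ℤ}

theorem sigmoid_neg (m : ℕ) (x : ℝ) : sigmoid m (-x) = -sigmoid m x := by
  simp [sigmoid, neg_div, (even_two_mul m).neg_pow]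

theorem sigmoid_zero (m : ℕ) : sigmoid m 0 = 0 := by
  simp [sigmoid]

theorem sigmoid_nonneg (hx : 0 ≤ x) : 0 ≤ sigmoid m x := by
  unfold sigmoid; positivity

theorem sigmoid_of_pos (hm : m ≠ 0) (hx : 0 < x) :
    sigmoid m x = 1 / (1 + (x ^ (2 * m))⁻¹) ^ (1 / (2 * (m : ℝ))) := by
  have hpow : 0 < x ^ (2 * m) := by positivity
  have hroot : (x ^ (2 * m)) ^ (1 / (2 * (m : ℝ))) = x := by
    simpa using Real.pow_rpow_inv_natCast hx.le (mul_ne_zero two_ne_zero hm)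
  have hfactor : 1 + x ^ (2 * m) = x ^ (2 * m) * (1 + (x ^ (2 * m))⁻¹) := by
    rw [mul_add, mul_one, mul_inv_cancel₀ hpow.ne', add_comm]
  rw [sigmoid, hfactor, Real.mul_rpow hpow.le (by positivity), hroot]
  field_simp

theorem monotone_sigmoid (hm : m ≠ 0) : Monotone (sigmoid m) := by
  refine monotone_of_odd_of_monotoneOn_nonneg (sigmoid_neg m) fun x hx y _ hxy => ?_
  rcases (Set.mem_Ici.1 hx).eq_or_lt with rfl | hx0
  · rw [sigmoid_zero]
    exact sigmoid_nonneg hxy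
  · have hy0 : 0 < y := hx0.trans_le hxy
    rw [sigmoid_of_pos hm hx0, sigmoid_of_pos hm hy0]
    gcongr

theorem sigmoid_le_one (hm : m ≠ 0) (x : ℝ) : sigmoid m x ≤ 1 := by
  rcases le_or_gt x 0 with hx | hx
  · exact (monotone_sigmoid hm hx).trans (by simp [sigmoid_zero])
  · rw [sigmoid_of_pos hm hx]
    refine (div_le_one (by positivity)).2 (Real.one_le_rpow ?_ (by positivity))
    simpa using by positivity

theorem neg_one_le_sigmoid (hm : m ≠ 0) (x : ℝ) : -1 ≤ sigmoid m x := by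
  rw [neg_le, ← sigmoid_neg]
  exact sigmoid_le_one hm (-x)

theorem one_sub_sigmoid_le (hm : m ≠ 0) (hx : 0 < x) :
    1 - sigmoid m x ≤ 1 / (2 * m * x ^ (2 * m)) := by
  have hm' : (1 : ℝ) ≤ m := Nat.one_le_cast.2 (Nat.one_le_iff_ne_zero.2 hm)
  have hu : 0 < (x ^ (2 * m))⁻¹ := by positivity
  have bernoulli : (1 + (x ^ (2 * m))⁻¹) ^ (1 / (2 * (m : ℝ))) ≤
      1 + 1 / (2 * m) * (x ^ (2 * m))⁻¹ :=
    rpow_one_add_le_one_add_mul_self (by linarith) (by positivity)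
      ((div_le_one (by positivity)).2 (by linarith))
  rw [← div_eq_mul_inv, div_div] at bernoulli
  have hv : 0 < 1 / (2 * m * x ^ (2 * m)) := by positivity
  rw [sigmoid_of_pos hm hx, sub_le_comm]
  calc 1 - 1 / (2 * m * x ^ (2 * m)) ≤ 1 / (1 + 1 / (2 * m * x ^ (2 * m))) := by
        rw [le_div_iff₀ (by positivity)]
        linarith [mul_pos hv hv]
    _ ≤ 1 / (1 + (x ^ (2 * m))⁻¹) ^ (1 / (2 * (m : ℝ))) :=
        one_div_le_one_div_of_le (by positivity) bernoulli

theorem sigmoid_add_le (hx : 0 ≤ x) (hy : 0 ≤ y) :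
    sigmoid m (x + y) ≤ sigmoid m x + sigmoid m y := by
  unfold sigmoid
  rw [add_div]
  gcongr <;> linarith

theorem sigmoid_two_pos (m : ℕ) : 0 < sigmoid m 2 := by
  unfold sigmoid; positivity

theorem four_div_sigmoid_two (m : ℕ) :
    4 / sigmoid m 2 = 2 * (1 + 4 ^ m : ℝ) ^ (1 / (2 * (m : ℝ))) := by
  rw [sigmoid, pow_mul, show (2 : ℝ) ^ 2 = 4 by norm_num, div_div_eq_mul_div]
  ring

theorem density_nonneg (hm : m ≠ 0) (x : ℝ) : 0 ≤ density m x :=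
  mul_nonneg (by norm_num) (sub_nonneg.2 (monotone_sigmoid hm (by linarith)))

theorem density_neg (m : ℕ) (x : ℝ) : density m (-x) = density m x := by
  rw [density, density, show -x + 1 = -(x - 1) by ring, show -x - 1 = -(x + 1) by ring,
    sigmoid_neg, sigmoid_neg, neg_sub_neg]

theorem sigmoid_two_div_four_le_density (hx : |x| ≤ 1) : sigmoid m 2 / 4 ≤ density m x := by
  obtain ⟨hx₁, hx₂⟩ := abs_le.1 hx
  have hadd := sigmoid_add_le (m := m) (show 0 ≤ x + 1 by linarith) (show 0 ≤ 1 - x by linarith)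
  rw [show x + 1 + (1 - x) = 2 by ring, ← neg_sub x 1, sigmoid_neg] at hadd
  rw [density]
  linarith

theorem sum_density_Icc (m : ℕ) (c : ℝ) (hpq : p ≤ q) :
    ∑ k ∈ Finset.Icc p q, density m (c - k) =
      (sigmoid m (c - p + 1) + sigmoid m (c - p) - sigmoid m (c - q) -
        sigmoid m (c - q - 1)) / 4 := by
  induction q, hpq using Int.leInduction with
  | base =>
    rw [Finset.Icc_self, Finset.sum_singleton, density]
    ring
  | succ q hpq ih =>
    have hsucc : p ≤ Order.succ q := hpq.trans (Order.le_succ q)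
    rw [← Order.succ_eq_add_one, ← Finset.insert_Icc_right_eq_Icc_succ hsucc,
      Finset.sum_insert (by simp), ih, density]
    simp only [Order.succ_eq_add_one, Int.cast_add, Int.cast_one, sub_add_eq_sub_sub,
      sub_add_cancel]
    ring

theorem sum_density_le_of_forall_le (hm : m ≠ 0) (c : ℝ) {S : Finset ℤ} (hS : ∀ k ∈ S, k ≤ q) :
    ∑ k ∈ S, density m (c - k) ≤ (2 - sigmoid m (c - q) - sigmoid m (c - q - 1)) / 4 := by
  obtain ⟨p, hp⟩ := S.bddBelow
  have hsub : S ⊆ Finset.Icc (min p q) q := fun k hk =>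
    Finset.mem_Icc.2 ⟨min_le_of_left_le (hp hk), hS k hk⟩
  have hsum := Finset.sum_le_sum_of_subset_of_nonneg hsub
    fun k _ _ => density_nonneg hm (c - k)
  rw [sum_density_Icc m c (min_le_right p q)] at hsum
  linarith [sigmoid_le_one hm (c - (min p q : ℤ) + 1), sigmoid_le_one hm (c - (min p q : ℤ))]

theorem sum_density_le_one (hm : m ≠ 0) (c : ℝ) (S : Finset ℤ) :
    ∑ k ∈ S, density m (c - k) ≤ 1 := by
  obtain ⟨q, hq⟩ := S.bddAbove
  have hsum := sum_density_le_of_forall_le hm c hq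
  linarith [neg_one_le_sigmoid hm (c - q), neg_one_le_sigmoid hm (c - q - 1)]

theorem sum_density_left_tail_le (hm : m ≠ 0) (hN : 1 < N) {S : Finset ℤ}
    (hS : ∀ k ∈ S, N < c - k) :
    ∑ k ∈ S, density m (c - k) ≤ 1 / (4 * m * (N - 1) ^ (2 * m)) := by
  have hfloor : N ≤ c - ⌊c - N⌋ := by linarith [Int.floor_le (c - N)]
  have hsum := sum_density_le_of_forall_le hm c (q := ⌊c - N⌋) fun k hk =>
    Int.le_floor.2 (by linarith [hS k hk])
  have hmono : sigmoid m (N - 1) ≤ sigmoid m (c - ⌊c - N⌋ - 1) :=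
    monotone_sigmoid hm (by linarith)
  have hmono' : sigmoid m (N - 1) ≤ sigmoid m (c - ⌊c - N⌋) :=
    monotone_sigmoid hm (by linarith)
  have hhalf : 1 / (4 * m * (N - 1) ^ (2 * m)) = 1 / (2 * m * (N - 1) ^ (2 * m)) / 2 := by
    rw [div_div]; ring
  linarith [one_sub_sigmoid_le hm (sub_pos.2 hN)]

theorem sum_density_right_tail_le (hm : m ≠ 0) (hN : 1 < N) {S : Finset ℤ}
    (hS : ∀ k ∈ S, N < k - c) :
    ∑ k ∈ S, density m (c - k) ≤ 1 / (4 * m * (N - 1) ^ (2 * m)) := by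
  have hreflect : ∑ k ∈ -S, density m (-c - k) = ∑ k ∈ S, density m (c - k) := by
    rw [Finset.sum_neg_index]
    refine Finset.sum_congr rfl fun k _ => ?_
    rw [← density_neg, Int.cast_neg, neg_sub_neg, neg_sub]
  rw [← hreflect]
  refine sum_density_left_tail_le hm hN fun k hk => ?_
  have := hS (-k) (Finset.mem_neg'.1 hk)
  push_cast at this
  linarith

theorem exists_mem_Icc_abs_sub_le_one (hpq : p ≤ q) (hp : p - 1 ≤ c) (hq : c ≤ q + 1) :
    ∃ k ∈ Finset.Icc p q, |c - (k : ℤ)| ≤ 1 := by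
  have hfloor := Int.floor_le c
  have hlt := Int.lt_floor_add_one c
  simp only [Finset.mem_Icc, abs_le]
  rcases lt_or_ge ⌊c⌋ p with h | h
  · have : (⌊c⌋ : ℝ) + 1 ≤ p := by exact_mod_cast h
    exact ⟨p, ⟨le_rfl, hpq⟩, by linarith, by linarith⟩
  · rcases le_or_gt ⌊c⌋ q with h' | h'
    · exact ⟨⌊c⌋, ⟨h, h'⟩, by linarith, by linarith⟩
    · have : (q : ℝ) + 1 ≤ ⌊c⌋ := by exact_mod_cast h'
      exact ⟨q, ⟨hpq, le_rfl⟩, by linarith, by linarith⟩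

theorem sigmoid_two_div_four_le_sum_density (hm : m ≠ 0) (hpq : p ≤ q) (hp : p - 1 ≤ c)
    (hq : c ≤ q + 1) :
    sigmoid m 2 / 4 ≤ ∑ k ∈ Finset.Icc p q, density m (c - k) := by
  obtain ⟨j, hj, hcj⟩ := exists_mem_Icc_abs_sub_le_one hpq hp hq
  exact (sigmoid_two_div_four_le_density hcj).trans
    (Finset.single_le_sum (f := fun k : ℤ => density m (c - k))
      (fun _ _ => density_nonneg hm _) hj)

end Density

section Operator

variable {X : Type*} [NormedAddCommGroup X] [NormedSpace ℝ X] {m n : ℕ} {a b x δ N τ : ℝ}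
  {f : ℝ → X} {y : X}

theorem enorm_centerMass_sub_le {ι : Type*} {t : Finset ι} {w : ι → ℝ} {z : ι → X}
    (hw : ∀ i ∈ t, 0 ≤ w i) (hpos : 0 < ∑ i ∈ t, w i) (y : X) :
    ‖t.centerMass w z - y‖ₑ ≤
      ENNReal.ofReal (∑ i ∈ t, w i)⁻¹ * ∑ i ∈ t, ENNReal.ofReal (w i) * ‖z i - y‖ₑ := by
  have hsub : t.centerMass w z - y = (∑ i ∈ t, w i)⁻¹ • ∑ i ∈ t, w i • (z i - y) := by
    simp only [smul_sub, Finset.sum_sub_distrib, ← Finset.sum_smul]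
    rw [inv_smul_smul₀ hpos.ne', Finset.centerMass]
  rw [hsub, enorm_smul, Real.enorm_of_nonneg (inv_nonneg.2 hpos.le)]
  gcongr
  refine (enorm_sum_le _ _).trans_eq (Finset.sum_congr rfl fun i hi => ?_)
  rw [enorm_smul, Real.enorm_of_nonneg (hw i hi)]

theorem sum_ofReal_density_mul_le (hm : m ≠ 0) {S : Finset ℤ} {c : ℝ}
    (hS : ∑ k ∈ S, density m (c - k) ≤ τ) (W : ℝ≥0∞) :
    ∑ k ∈ S, ENNReal.ofReal (density m (c - k)) * W ≤ ENNReal.ofReal τ * W := by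
  rw [← Finset.sum_mul, ← ENNReal.ofReal_sum_of_nonneg fun k _ => density_nonneg hm _]
  gcongr

theorem sum_ofReal_density_mul_add_ite_le (hm : m ≠ 0) (hN : 1 < N) (S : Finset ℤ) (c : ℝ)
    (W L R : ℝ≥0∞) :
    ∑ k ∈ S, ENNReal.ofReal (density m (c - k)) *
        (W + (if N < c - k then L else 0) + if N < k - c then R else 0) ≤
      W + ENNReal.ofReal (1 / (4 * m * (N - 1) ^ (2 * m))) * (L + R) := by
  simp only [mul_add, Finset.sum_add_distrib, mul_ite, mul_zero, ← Finset.sum_filter, ← add_assoc]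
  gcongr ?_ + ?_ + ?_
  · simpa using sum_ofReal_density_mul_le hm (sum_density_le_one hm c S) W
  · exact sum_ofReal_density_mul_le hm
      (sum_density_left_tail_le hm hN fun k hk => (Finset.mem_filter.1 hk).2) L
  · exact sum_ofReal_density_mul_le hm
      (sum_density_right_tail_le hm hN fun k hk => (Finset.mem_filter.1 hk).2) R

theorem div_mem_Icc {k : ℤ} (hn : 0 < (n : ℝ)) (hk : k ∈ Finset.Icc ⌈n * a⌉ ⌊n * b⌋) :
    (k : ℝ) / n ∈ Set.Icc a b := by
  obtain ⟨hak, hkb⟩ := Finset.mem_Icc.1 hk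
  rw [Set.mem_Icc, le_div_iff₀' hn, div_le_iff₀' hn]
  exact ⟨Int.ceil_le.1 hak, Int.le_floor.1 hkb⟩

theorem enorm_netOp_sub_le (hm : m ≠ 0) (hδ : 1 < n * δ)
    (hab_n : ⌈(n : ℝ) * a⌉ ≤ ⌊(n : ℝ) * b⌋) (hx : x ∈ Set.Icc a b) {W L R : ℝ≥0∞}
    (hf : ∀ u ∈ Set.Icc a b, ‖f u - y‖ₑ ≤
      W + (if δ < x - u then L else 0) + if δ < u - x then R else 0) :
    ‖netOp m a b n f x - y‖ₑ ≤ ENNReal.ofReal (4 / sigmoid m 2) *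
      (W + ENNReal.ofReal (1 / (4 * m * (n * δ - 1) ^ (2 * m))) * (L + R)) := by
  have hn : (0 : ℝ) < n := Nat.cast_pos.2 (Nat.pos_of_ne_zero fun h => by norm_num [h] at hδ)
  have hsum : sigmoid m 2 / 4 ≤
      ∑ k ∈ Finset.Icc ⌈(n : ℝ) * a⌉ ⌊(n : ℝ) * b⌋, density m (n * x - k) :=
    sigmoid_two_div_four_le_sum_density hm hab_n
      (by nlinarith [Int.ceil_lt_add_one ((n : ℝ) * a), hx.1])
      (by nlinarith [Int.lt_floor_add_one ((n : ℝ) * b), hx.2])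
  have hpos : 0 < sigmoid m 2 / 4 := div_pos (sigmoid_two_pos m) four_pos
  refine (enorm_centerMass_sub_le (fun k _ => density_nonneg hm _) (hpos.trans_le hsum) y).trans ?_
  gcongr ENNReal.ofReal ?_ * ?_
  · rw [← inv_div]
    exact inv_anti₀ hpos hsum
  · refine (Finset.sum_le_sum fun k hk => ?_).trans
      (sum_ofReal_density_mul_add_ite_le hm hδ _ (n * x) W L R)
    gcongr
    have hleft : n * δ < n * x - k ↔ δ < x - k / n := by
      rw [← lt_div_iff₀' hn, sub_div, mul_div_cancel_left₀ _ hn.ne']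
    have hright : n * δ < k - n * x ↔ δ < k / n - x := by
      rw [← lt_div_iff₀' hn, sub_div, mul_div_cancel_left₀ _ hn.ne']
    simpa only [hleft, hright] using hf _ (div_mem_Icc hn hk)

theorem enorm_netOp_sub_le_caputo [CompleteSpace X] {α : ℝ} (hα : α ∈ Set.Ioo 0 1) (hab : a < b)
    (hf : ContDiffOn ℝ 1 f (Set.Icc a b)) (hm : m ≠ 0) (hδ : 2 < n * δ)
    (hab_n : ⌈(n : ℝ) * a⌉ ≤ ⌊(n : ℝ) * b⌋) (hx : x ∈ Set.Icc a b) :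
    ‖netOp m a b n f x - f x‖ₑ ≤
      ENNReal.ofReal (2 * (1 + 4 ^ m : ℝ) ^ (1 / (2 * (m : ℝ))) / Real.Gamma (α + 1)) *
        ((modulus (caputoRight α a b f x) δ (Set.Icc a x) +
            modulus (caputoLeft α a b f x) δ (Set.Icc x b)) * ENNReal.ofReal (δ ^ α) +
          ENNReal.ofReal (1 / (4 * m * (n * δ - 2) ^ (2 * m))) *
            (supNorm (caputoRight α a b f x) (Set.Icc a x) * ENNReal.ofReal ((x - a) ^ α) +
              supNorm (caputoLeft α a b f x) (Set.Icc x b) * ENNReal.ofReal ((b - x) ^ α))) := by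
  have hδ0 : 0 ≤ δ := (pos_of_mul_pos_right (two_pos.trans hδ) n.cast_nonneg).le
  have hΓ : 0 < (Real.Gamma (α + 1))⁻¹ := inv_pos.2 (Real.Gamma_pos_of_pos (by linarith [hα.1]))
  have hsplit (r : ℝ) : ENNReal.ofReal (r / Real.Gamma (α + 1)) =
      ENNReal.ofReal r * ENNReal.ofReal (Real.Gamma (α + 1))⁻¹ := by
    rw [div_eq_mul_inv, ENNReal.ofReal_mul' hΓ.le]
  have htail : 1 / (4 * (m : ℝ) * (n * δ - 1) ^ (2 * m)) ≤
      1 / (4 * m * (n * δ - 2) ^ (2 * m)) := by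
    have := sub_pos.2 hδ
    gcongr
    norm_num
  refine (enorm_netOp_sub_le hm (one_lt_two.trans hδ) hab_n hx fun u hu =>
    enorm_sub_le_modulus_caputo hα hab hf hδ0 hx hu).trans ?_
  refine (mul_le_mul_right (add_le_add_right
    (mul_le_mul_left (ENNReal.ofReal_le_ofReal htail) _) _) _).trans_eq ?_
  rw [← four_div_sigmoid_two]
  simp only [hsplit]
  ring

end Operator

section Specialization

variable {r : ℝ}

theorem pos_of_one_lt_rpow {s : ℝ} (hr : 0 ≤ r) (hrs : 1 < r ^ s) : 0 < r := by
  refine hr.lt_of_ne fun h => hrs.not_ge ?_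
  rw [← h]
  exact Real.zero_rpow_le_one s

theorem mul_one_div_rpow (hr : 0 < r) (β : ℝ) : r * (1 / r ^ β) = r ^ (1 - β) := by
  rw [mul_one_div, Real.rpow_sub hr, Real.rpow_one]

theorem mul_ofReal_sqrt_one_div_rpow (hr : 0 < r) (β : ℝ) (ω : ℝ≥0∞) :
    ω * ENNReal.ofReal √(1 / r ^ β) = ω / ENNReal.ofReal (r ^ (β / 2)) := by
  rw [Real.sqrt_eq_rpow, div_eq_mul_one_div β, Real.rpow_mul hr.le, one_div (r ^ β),
    Real.inv_rpow (by positivity), ENNReal.ofReal_inv_of_pos (by positivity),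
    ENNReal.div_eq_inv_mul, mul_comm]

theorem two_mul_div_Gamma_one_half_add_one (K : ℝ) :
    2 * K / Real.Gamma (1 / 2 + 1) = 4 * K / √Real.pi := by
  rw [Real.Gamma_add_one (by norm_num), Real.Gamma_one_half_eq]
  field_simp
  ring

end Specialization

end NeuralFrac

open NeuralFrac in
theorem corollary32_general {X : Type*} [NormedAddCommGroup X] [NormedSpace ℝ X] [CompleteSpace X]
    {α a b δ : ℝ} {m n : ℕ} {f : ℝ → X} (hα : α ∈ Set.Ioo 0 1) (hab : a < b)
    (hf : ContDiffOn ℝ 1 f (Set.Icc a b)) (hm : m ≠ 0) (hδ : 2 < n * δ)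
    (hab_n : ⌈(n : ℝ) * a⌉ ≤ ⌊(n : ℝ) * b⌋) :
    (∀ x ∈ Set.Icc a b, ‖netOp m a b n f x - f x‖ₑ ≤
      ENNReal.ofReal (2 * (1 + 4 ^ m : ℝ) ^ (1 / (2 * (m : ℝ))) / Real.Gamma (α + 1)) *
        ((modulus (caputoRight α a b f x) δ (Set.Icc a x) +
            modulus (caputoLeft α a b f x) δ (Set.Icc x b)) * ENNReal.ofReal (δ ^ α) +
          ENNReal.ofReal (1 / (4 * m * (n * δ - 2) ^ (2 * m))) *
            (supNorm (caputoRight α a b f x) (Set.Icc a x) * ENNReal.ofReal ((x - a) ^ α) +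
              supNorm (caputoLeft α a b f x) (Set.Icc x b) * ENNReal.ofReal ((b - x) ^ α)))) ∧
    supNorm (fun x => netOp m a b n f x - f x) (Set.Icc a b) ≤
      ENNReal.ofReal (2 * (1 + 4 ^ m : ℝ) ^ (1 / (2 * (m : ℝ))) / Real.Gamma (α + 1)) *
        (((⨆ x ∈ Set.Icc a b, modulus (caputoRight α a b f x) δ (Set.Icc a x)) +
            ⨆ x ∈ Set.Icc a b, modulus (caputoLeft α a b f x) δ (Set.Icc x b)) *
            ENNReal.ofReal (δ ^ α) +
          ENNReal.ofReal ((b - a) ^ α / (4 * m * (n * δ - 2) ^ (2 * m))) *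
            ((⨆ x ∈ Set.Icc a b, supNorm (caputoRight α a b f x) (Set.Icc a x)) +
              ⨆ x ∈ Set.Icc a b, supNorm (caputoLeft α a b f x) (Set.Icc x b))) ∧
    ENNReal.ofReal (2 * (1 + 4 ^ m : ℝ) ^ (1 / (2 * (m : ℝ))) / Real.Gamma (α + 1)) *
        (((⨆ x ∈ Set.Icc a b, modulus (caputoRight α a b f x) δ (Set.Icc a x)) +
            ⨆ x ∈ Set.Icc a b, modulus (caputoLeft α a b f x) δ (Set.Icc x b)) *
            ENNReal.ofReal (δ ^ α) +
          ENNReal.ofReal ((b - a) ^ α / (4 * m * (n * δ - 2) ^ (2 * m))) *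
            ((⨆ x ∈ Set.Icc a b, supNorm (caputoRight α a b f x) (Set.Icc a x)) +
              ⨆ x ∈ Set.Icc a b, supNorm (caputoLeft α a b f x) (Set.Icc x b))) < ∞ := by
  have hpointwise := fun x => enorm_netOp_sub_le_caputo (m := m) (x := x) hα hab hf hm hδ hab_n
  have hright := biSup_supNorm_caputoRight_lt_top hα hab hf
  have hleft := biSup_supNorm_caputoLeft_lt_top hα hab hf
  refine ⟨hpointwise, iSup₂_le fun x hx => (hpointwise x hx).trans ?_, ?_⟩
  · have hwidth (p q : ℝ≥0∞) :
        ENNReal.ofReal ((b - a) ^ α / (4 * m * (n * δ - 2) ^ (2 * m))) * (p + q) =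
          ENNReal.ofReal (1 / (4 * m * (n * δ - 2) ^ (2 * m))) *
            (p * ENNReal.ofReal ((b - a) ^ α) + q * ENNReal.ofReal ((b - a) ^ α)) := by
      rw [← one_div_mul_eq_div, ENNReal.ofReal_mul (by positivity)]
      ring
    rw [hwidth]
    have hxa := sub_nonneg.2 hx.1
    have hbx := sub_nonneg.2 hx.2
    have hα0 := hα.1.le
    gcongr
    · exact le_biSup (fun x => modulus (caputoRight α a b f x) δ (Set.Icc a x)) hx
    · exact le_biSup (fun x => modulus (caputoLeft α a b f x) δ (Set.Icc x b)) hx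
    · exact le_biSup (fun x => supNorm (caputoRight α a b f x) (Set.Icc a x)) hx
    · exact hx.2
    · exact le_biSup (fun x => supNorm (caputoLeft α a b f x) (Set.Icc x b)) hx
    · exact hx.1
  · have hfinite := ENNReal.add_lt_top.2
      ⟨biSup_modulus_lt_top hright δ, biSup_modulus_lt_top hleft δ⟩
    exact ENNReal.mul_lt_top ENNReal.ofReal_lt_top (ENNReal.add_lt_top.2
      ⟨ENNReal.mul_lt_top hfinite ENNReal.ofReal_lt_top,
        ENNReal.mul_lt_top ENNReal.ofReal_lt_top (ENNReal.add_lt_top.2 ⟨hright, hleft⟩)⟩)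

theorem corollary32 {X : Type*} [NormedAddCommGroup X] [NormedSpace ℝ X] [CompleteSpace X]
    (a b : ℝ) (hab : a < b) (f : ℝ → X) (hf : ContDiffOn ℝ 1 f (Set.Icc a b))
    (β : ℝ) (hβ0 : 0 < β) (hβ1 : β < 1) (m : ℕ) (hm : 1 ≤ m)
    (n : ℕ) (hn : 2 < (n : ℝ) ^ (1 - β)) (hab_n : ⌈(n : ℝ) * a⌉ ≤ ⌊(n : ℝ) * b⌋) :
    (∀ x ∈ Set.Icc a b,
      ‖NeuralFrac.netOp m a b n f x - f x‖ₑ ≤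
        ENNReal.ofReal (4 * (1 + 4 ^ m : ℝ) ^ (1 / (2 * (m : ℝ))) / √Real.pi) *
          ((NeuralFrac.modulus (NeuralFrac.caputoRight (1 / 2) a b f x)
                (1 / (n : ℝ) ^ β) (Set.Icc a x) +
              NeuralFrac.modulus (NeuralFrac.caputoLeft (1 / 2) a b f x)
                (1 / (n : ℝ) ^ β) (Set.Icc x b)) /
              ENNReal.ofReal ((n : ℝ) ^ (β / 2)) +
            ENNReal.ofReal (1 / (4 * (m : ℝ) * ((n : ℝ) ^ (1 - β) - 2) ^ (2 * m))) *
              (NeuralFrac.supNorm (NeuralFrac.caputoRight (1 / 2) a b f x) (Set.Icc a x) *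
                  ENNReal.ofReal √(x - a) +
                NeuralFrac.supNorm (NeuralFrac.caputoLeft (1 / 2) a b f x) (Set.Icc x b) *
                  ENNReal.ofReal √(b - x)))) ∧
    NeuralFrac.supNorm (fun x => NeuralFrac.netOp m a b n f x - f x) (Set.Icc a b) ≤
      ENNReal.ofReal (4 * (1 + 4 ^ m : ℝ) ^ (1 / (2 * (m : ℝ))) / √Real.pi) *
        (((⨆ x ∈ Set.Icc a b, NeuralFrac.modulus (NeuralFrac.caputoRight (1 / 2) a b f x)
                (1 / (n : ℝ) ^ β) (Set.Icc a x)) +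
            (⨆ x ∈ Set.Icc a b, NeuralFrac.modulus (NeuralFrac.caputoLeft (1 / 2) a b f x)
                (1 / (n : ℝ) ^ β) (Set.Icc x b))) /
            ENNReal.ofReal ((n : ℝ) ^ (β / 2)) +
          ENNReal.ofReal (√(b - a) / (4 * (m : ℝ) * ((n : ℝ) ^ (1 - β) - 2) ^ (2 * m))) *
            ((⨆ x ∈ Set.Icc a b,
                NeuralFrac.supNorm (NeuralFrac.caputoRight (1 / 2) a b f x) (Set.Icc a x)) +
              (⨆ x ∈ Set.Icc a b,
                NeuralFrac.supNorm (NeuralFrac.caputoLeft (1 / 2) a b f x) (Set.Icc x b)))) ∧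
    ENNReal.ofReal (4 * (1 + 4 ^ m : ℝ) ^ (1 / (2 * (m : ℝ))) / √Real.pi) *
        (((⨆ x ∈ Set.Icc a b, NeuralFrac.modulus (NeuralFrac.caputoRight (1 / 2) a b f x)
                (1 / (n : ℝ) ^ β) (Set.Icc a x)) +
            (⨆ x ∈ Set.Icc a b, NeuralFrac.modulus (NeuralFrac.caputoLeft (1 / 2) a b f x)
                (1 / (n : ℝ) ^ β) (Set.Icc x b))) /
            ENNReal.ofReal ((n : ℝ) ^ (β / 2)) +
          ENNReal.ofReal (√(b - a) / (4 * (m : ℝ) * ((n : ℝ) ^ (1 - β) - 2) ^ (2 * m))) *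
            ((⨆ x ∈ Set.Icc a b,
                NeuralFrac.supNorm (NeuralFrac.caputoRight (1 / 2) a b f x) (Set.Icc a x)) +
              (⨆ x ∈ Set.Icc a b,
                NeuralFrac.supNorm (NeuralFrac.caputoLeft (1 / 2) a b f x) (Set.Icc x b)))) < ∞ := by
  have hn0 := NeuralFrac.pos_of_one_lt_rpow n.cast_nonneg (one_lt_two.trans hn)
  have hδ := NeuralFrac.mul_one_div_rpow hn0 β
  simpa only [hδ, ← Real.sqrt_eq_rpow, NeuralFrac.mul_ofReal_sqrt_one_div_rpow hn0,
    NeuralFrac.two_mul_div_Gamma_one_half_add_one] using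
    corollary32_general (α := 1 / 2) ⟨by norm_num, by norm_num⟩ hab hf
      (Nat.one_le_iff_ne_zero.1 hm) (hn.trans_eq hδ.symm) hab_n
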